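/- Let $f :\subseteq \{0,1\}^{\mathbb{N}} \to \{0,1\}^{\mathbb{N}}$ be an arbitrary partial function. For $\mathcal{X} \in \{\{0,1\}^{\mathbb{N}}, \mathbb{N}^{\mathbb{N}}\}$ let $(U_n)_{n\in\mathbb{N}}$ be the standard total effective enumeration of the computably open subsets of $\mathcal{X}$, where $U_n$ is the union of the cylinders given by the words in the $n$-th computably enumerable set of words. A set $D \subseteq \operatorname{dom}(f)$ is a computably $\Delta^0_2$ subset of the subspace $\operatorname{dom}(f)$ if $D=\bigcup_{i} A_i=\bigcap_{i} V_i$ for a computable sequence $(A_i)_i$ of computably closed and a computable sequence $(V_i)_i$ of computably open subsets of $\operatorname{dom}(f)$ (in the relative topology); let $(D_n)_n$ be the standard effective partial enumeration of these sets, where the index $n$ encodes the two computable sequences and is valid if and only if the union and the intersection agree. The function $f$ is called Markov-effectively $\Delta^0_2$-measurable if there is a partial computable function $P :\subseteq \mathbb{N}\to\mathbb{N}$ such that for every $n$, $P(n)$ is defined and is a valid index with $D_{P(n)} = f^{-1}(U_n)$, where $(U_n)_n$ enumerates the computably open subsets of $\{0,1\}^{\mathbb{N}}$. Let $J : \mathbb{N}^{\mathbb{N}}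 \to \mathbb{N}^{\mathbb{N}}$ be the Turing jump, $J(q)(n) = 1$ if $q \in U_n$ and $J(q)(n)=0$ otherwise, with $(U_n)_n$ the enumeration for $\mathbb{N}^{\mathbb{N}}$. Let $\mathfrak{L} :\subseteq \mathcal{C}(\mathbb{N},\mathbb{N}^{\mathbb{N}}) \to \mathbb{N}^{\mathbb{N}}$ be the partial function given by $\mathfrak{L}((p_i)_{i\in\mathbb{N}}) = q$ if and only if $\lim_{i\to\infty} p_i = J(q)$ in $\mathbb{N}^{\mathbb{N}}$. All spaces carry their standard representations by names in $\{0,1\}^{\mathbb{N}}$. A realizer of a partial function $g$ between represented spaces is a partial function on $\{0,1\}^{\mathbb{N}}$ that sends each name of each point $x \in \operatorname{dom}(g)$ to a name of $g(x)$. Strong Weihrauch reducibility $f \leq_{sW} g$ means that there are (Type-2) computable $H, K :\subseteq \{0,1\}^{\mathbb{N}} \to \{0,1\}^{\mathbb{N}}$ such that $H \circ G \circ K$ is a realizer of $f$ for every realizer $G$ of $g$. Then $f$ is Markov-effectively $\Delta^0_2$-measurable if and only if $f \leq_{sW} \mathfrak{L}$. -/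

import Mathlib

/-! ### Type-2 computability, Weihrauch reducibility and Markov-effective measurability -/

namespace TTE

/-- Cantor space `{0,1}^ℕ`. -/
abbrev Cantor : Type := ℕ → Bool

/-- Baire space `ℕ^ℕ`. -/
abbrev Baire : Type := ℕ → ℕ

/-- The finite word `p(0) p(1) … p(k-1)`. -/
def initSeg {α : Type} (p : ℕ → α) (k : ℕ) : List α := (List.range k).map p

/-- Type-2 computability of a partial function `F` on Cantor space: a computable, prefix-monotone
function `M` on finite words (what the machine has written after reading a finite part of its
input) approximates `F`. On every `p` in the domain of `F` the words `M (initSeg p k)` grow to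
the infinite sequence `F p`; nothing is required outside the domain. -/
def IsComputable (F : Cantor →. Cantor) : Prop :=
  ∃ M : List Bool → List Bool, Computable M ∧
    (∀ u v : List Bool, u <+: v → M u <+: M v) ∧
    ∀ p q : Cantor, q ∈ F p → ∀ n : ℕ, ∃ k : ℕ, initSeg q n <+: M (initSeg p k)

/-- A representation of `X`: a partial surjection from Cantor space onto `X`. -/
structure Representation (X : Type) where
  /-- the partial map sending a name to the point it denotes -/
  toPFun : Cantor →. X
  /-- every point has a name -/
  surj : ∀ x : X, ∃ p : Cantor, x ∈ toPFun p

/-- The representation in which `x` has the single name `e x`, for an injection `e`. -/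
noncomputable def Representation.ofInjective {X : Type} (e : X → Cantor)
    (he : Function.Injective e) : Representation X where
  toPFun := fun r => ⟨∃ x, e x = r, fun h => h.choose⟩
  surj := fun x => ⟨e x, ⟨x, rfl⟩, he (Exists.choose_spec (⟨x, rfl⟩ : ∃ y, e y = e x))⟩

theorem Representation.mem_ofInjective {X : Type} (e : X → Cantor) (he : Function.Injective e)
    (r : Cantor) (x : X) : x ∈ (Representation.ofInjective e he).toPFun r ↔ e x = r := by
  constructor
  · rintro ⟨h, rfl⟩
    exact h.choose_spec
  · intro hx
    exact ⟨⟨x, hx⟩, he ((Exists.choose_spec (⟨x, hx⟩ : ∃ y, e y = r)).trans hx.symm)⟩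

/-- The characteristic function of the graph of `p`. -/
def graphName (p : Baire) : Cantor := fun k => decide (p k.unpair.1 = k.unpair.2)

theorem graphName_injective : Function.Injective graphName := by
  intro p q h
  funext n
  have h1 := congrFun h (Nat.pair n (p n))
  simpa [graphName, eq_comm] using h1

/-- The join of a sequence of points of Baire space. -/
def join (p : ℕ → Baire) : Baire := fun k => p k.unpair.1 k.unpair.2

theorem join_injective : Function.Injective join := by
  intro p q h
  funext i n
  have h1 := congrFun h (Nat.pair i n)
  simpa [join] using h1

/-- Cantor space, represented by the identity. -/
noncomputable def reprCantor : Representation Cantor :=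
  Representation.ofInjective id Function.injective_id

/-- Baire space: the name of `p` is the characteristic function of the graph of `p`. -/
noncomputable def reprBaire : Representation Baire :=
  Representation.ofInjective graphName graphName_injective

/-- Sequences in Baire space, that is (continuous) functions from `ℕ` to `ℕ^ℕ`: the name of a
sequence is the name of its join. -/
noncomputable def reprBaireSeq : Representation (ℕ → Baire) :=
  Representation.ofInjective (graphName ∘ join) (graphName_injective.comp join_injective)

/-- A partial multivalued function from `X` to `Y`: `f x` is the set of admissible values, and the
domain of `f` consists of those `x` for which `f x` is nonempty. -/
abbrev MultiMap (X Y : Type) : Type := X → Set Y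

/-- A partial function as a partial multivalued one. -/
def toMulti {X Y : Type} (f : X →. Y) : MultiMap X Y := fun x => {y | y ∈ f x}

/-- `F` realizes `f`: it sends every name of a point `x` in the domain of `f` to a name of some
value in `f x`. -/
def IsRealizer {X Y : Type} (δX : Representation X) (δY : Representation Y)
    (F : Cantor →. Cantor) (f : MultiMap X Y) : Prop :=
  ∀ (p : Cantor) (x : X), x ∈ δX.toPFun p → (f x).Nonempty →
    ∃ q ∈ F p, ∃ y ∈ δY.toPFun q, y ∈ f x

/-- Strong Weihrauch reducibility `f ≤_sW g`. -/
def StrongWeihrauchLE {X Y U V : Type}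
    (δX : Representation X) (δY : Representation Y) (δU : Representation U) (δV : Representation V)
    (f : MultiMap X Y) (g : MultiMap U V) : Prop :=
  ∃ H K : Cantor →. Cantor, IsComputable H ∧ IsComputable K ∧
    ∀ G : Cantor →. Cantor, IsRealizer δU δV G g → IsRealizer δX δY (H.comp (G.comp K)) f

/-- `WDom n a`: the `n`-th partial recursive function is defined at (the code of) `a`. -/
def WDom {α : Type} [Primcodable α] (n : ℕ) (a : α) : Prop :=
  (Nat.Partrec.Code.eval (Denumerable.ofNat Nat.Partrec.Code n) (Encodable.encode a)).Dom

/-- The effective enumeration `(U_n)` of the computably open subsets of `α^ℕ`: `U_n` is the union of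
the cylinders given by the words in the `n`-th computably enumerable set of words. -/
def openSet {α : Type} [Primcodable α] (n : ℕ) : Set (ℕ → α) :=
  {p | ∃ k : ℕ, WDom n (initSeg p k)}

/-- The `n`-th computable sequence of computably open subsets of Cantor space. -/
def openSeq (n i : ℕ) : Set Cantor :=
  {p | ∃ k : ℕ, WDom n (i, initSeg p k)}

/-- `IsDeltaIndex X n D`: in the effective partial enumeration of the computably `Δ⁰₂` subsets of
the subspace `X` of Cantor space, the index `n = ⟨a, b⟩` is valid and denotes `D`. Here `a` gives a
computable sequence of closed sets `A_i` (through their complements) and `b` a computable sequence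
of open sets `U_i` of `X`, and `D = ⋃ i, A_i = ⋂ i, U_i`. -/
def IsDeltaIndex (X : Set Cantor) (n : ℕ) (D : Set Cantor) : Prop :=
  D = {p | p ∈ X ∧ ∃ i : ℕ, p ∉ openSeq n.unpair.1 i} ∧
    D = {p | p ∈ X ∧ ∀ i : ℕ, p ∈ openSeq n.unpair.2 i}

/-- Markov-effective `Δ⁰₂`-measurability of a partial function on Cantor space: some partial
computable `P` sends each index of an open set to an index, relative to the subspace `dom f`, of
its preimage. -/
def IsMarkovDeltaMeasurable (f : Cantor →. Cantor) : Prop :=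
  ∃ P : ℕ →. ℕ, Nat.Partrec P ∧
    ∀ n : ℕ, ∃ m ∈ P n, IsDeltaIndex f.Dom m (f.preimage (openSet n))

open Classical in
/-- The Turing jump: `J(q)(n) = 1` if `q ∈ U_n`, and `J(q)(n) = 0` otherwise. -/
noncomputable def jump (q : Baire) : Baire := fun n => if q ∈ openSet n then 1 else 0

/-- The map `𝔏`: a sequence converging (in Baire space) to `J(q)` is sent to `q`. -/
def lowMap : MultiMap (ℕ → Baire) Baire :=
  fun p => {q | Filter.Tendsto p Filter.atTop (nhds (jump q))}

end TTE

/-! Both sides say that, for `p` in `dom f`, the truth values of `f p ∈ U_n` are limits of values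
computed from `p`, uniformly in `n`.

From measurability to a reduction: let `D = ⋃ A_i = ⋂ V_i`. Reading longer and longer prefixes of
`p`, count how many initial complements of the `A_i`, and how many initial `V_i`, have been seen to
contain `p`. On `D` the first count is bounded and the second tends to infinity; on `dom f \ D` the
roles are exchanged. Comparing them gives guesses that converge to membership
(`IsDeltaIndex.eventually_deltaGuess`). Applied to the preimages of all `U_n`, these guesses
converge to the jump of `f p`, viewed in Baire space. As the jump is injective, every realizer of
`lowMap` then has to return that point.

From a reduction to measurability: `K p` names a sequence `x` converging to `J(q)`, and `H` maps the
name of `q` to `f p`. Pulling `U_n` back along `H` gives an open set of index `s n`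
(`exists_openSet_index_machine`), so `f p ∈ U_n` iff `x j (s n)` tends to 1. For a convergent
sequence, "eventually 1" and "infinitely often 1" agree; the former is a union of closed sets, the
latter an intersection of open sets (`exists_openSeq_index_tail`). -/

namespace TTE

open Nat.Partrec (Code)
open Encodable Denumerable

/-! ### Step-bounded halting and enumeration of semidecidable sets -/

section Computability

variable {α β γ σ : Type} [Primcodable α] [Primcodable β] [Primcodable γ] [Primcodable σ]

theorem primrec_list_any {f : α → List β} {p : α → β → Bool} (hf : Primrec f) (hp : Primrec₂ p) :
    Primrec fun a => (f a).any (p a) := by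
  have h : Primrec fun a => decide ((f a).findIdx (p a) < (f a).length) :=
    PrimrecPred.decide
      (PrimrecRel.comp Primrec.nat_lt (Primrec.list_findIdx hf hp) (Primrec.list_length.comp hf))
  refine h.of_eq fun a => ?_
  rw [Bool.eq_iff_iff]
  simp [List.findIdx_lt_length]

theorem computable_list_map_range {f : α → ℕ} {g : α → ℕ → σ} (hf : Computable f)
    (hg : Computable₂ g) : Computable fun a => (List.range (f a)).map (g a) := by
  have hstep : Computable₂ fun (a : α) (s : ℕ × List σ) => s.2 ++ [g a s.1] :=
    Computable.list_concat.comp (Computable.snd.comp Computable.snd)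
      (hg.comp Computable.fst (Computable.fst.comp Computable.snd))
  refine (Computable.nat_rec hf (Computable.const ([] : List σ)) hstep).of_eq fun a => ?_
  induction f a with
  | zero => rfl
  | succ n ih => simp only [List.range_succ, List.map_append, List.map_singleton, ← ih]

/-- The `n`-th partial recursive function halts at `a` within the step bound `k`. -/
def haltsBy (k n : ℕ) (a : α) : Bool := (Code.evaln k (ofNat Code n) (encode a)).isSome

theorem computable_haltsBy {f g : α → ℕ} {h : α → β} (hf : Computable f) (hg : Computable g)
    (hh : Computable h) : Computable fun a => haltsBy (f a) (g a) (h a) :=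
  Primrec.option_isSome.to_comp.comp (Code.primrec_evaln.to_comp.comp
    (Computable.pair (Computable.pair hf ((Computable.ofNat Code).comp hg))
      (Computable.encode.comp hh)))

theorem primrec_haltsBy {f g : α → ℕ} {h : α → β} (hf : Primrec f) (hg : Primrec g)
    (hh : Primrec h) : Primrec fun a => haltsBy (f a) (g a) (h a) :=
  Primrec.option_isSome.comp (Code.primrec_evaln.comp
    (Primrec.pair (Primrec.pair hf ((Primrec.ofNat Code).comp hg)) (Primrec.encode.comp hh)))

theorem haltsBy_mono {k k' n : ℕ} {a : α} (hk : k ≤ k') (h : haltsBy k n a) :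
    haltsBy k' n a := by
  obtain ⟨x, hx⟩ := Option.isSome_iff_exists.1 h
  exact Option.isSome_iff_exists.2 ⟨x, Code.evaln_mono hk hx⟩

theorem wDom_iff_haltsBy {n : ℕ} {a : α} : WDom n a ↔ ∃ k, haltsBy k n a := by
  simp only [WDom, Part.dom_iff_mem, Code.evaln_complete, haltsBy, Option.isSome_iff_exists]
  exact exists_comm

/-- Semidecidable relations are uniformly enumerated: the `s`-`m`-`n` theorem for domains. -/
theorem exists_wDom_index {T : ℕ → α → ℕ → Bool}
    (hT : Computable fun x : (ℕ × α) × ℕ => T x.1.1 x.1.2 x.2) :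
    ∃ s : ℕ → ℕ, Computable s ∧ ∀ n a, WDom (s n) a ↔ ∃ k, T n a k := by
  have hr : Partrec fun x : ℕ × α => Nat.rfind fun k => Part.some (T x.1 x.2 k) :=
    Partrec.rfind (p := fun (x : ℕ × α) k => Part.some (T x.1 x.2 k)) hT.partrec
  obtain ⟨c, hc⟩ := Code.exists_code.1 hr
  refine ⟨fun n => encode (c.curry n),
    Computable.encode.comp (Code.primrec₂_curry.to_comp.comp (Computable.const c) Computable.id),
    fun n a => ?_⟩
  have hpair : Nat.pair n (encode a) = encode (n, a) := by simp
  rw [WDom, ofNat_encode, Code.eval_curry, hc, hpair]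
  simp only [encodek, Part.coe_some, Part.bind_some, Part.map_Dom]
  exact Nat.rfind_dom.trans (by simp)

end Computability

/-! ### Initial segments -/

section Words

variable {α : Type}

theorem length_initSeg (p : ℕ → α) (k : ℕ) : (initSeg p k).length = k := by simp [initSeg]

theorem getElem?_initSeg {p : ℕ → α} {k i : ℕ} (h : i < k) : (initSeg p k)[i]? = some (p i) := by
  simp [initSeg, h]

theorem take_initSeg {p : ℕ → α} {k i : ℕ} (h : i ≤ k) : (initSeg p k).take i = initSeg p i := by
  simp [initSeg, ← List.map_take, List.take_range, h]

theorem map_initSeg {β : Type} (g : α → β) (p : ℕ → α) (k : ℕ) :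
    (initSeg p k).map g = initSeg (g ∘ p) k := by simp [initSeg]

theorem initSeg_prefix {p : ℕ → α} {j k : ℕ} (h : j ≤ k) : initSeg p j <+: initSeg p k :=
  take_initSeg (p := p) h ▸ List.take_prefix _ _

theorem eq_of_prefix_initSeg {p : ℕ → α} {w : List α} {k : ℕ} (h : w <+: initSeg p k) :
    w = initSeg p w.length := by
  have hl : w.length ≤ k := length_initSeg p k ▸ h.length_le
  rw [← take_initSeg hl]
  exact List.prefix_iff_eq_take.1 h

end Words

/-! ### Machines on finite words -/

/-- The machine `M` produces exactly the initial segments of `F p` from those of `p`. -/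
structure Computes (M : List Bool → List Bool) (p q : Cantor) : Prop where
  eq_initSeg : ∀ k, M (initSeg p k) = initSeg q (M (initSeg p k)).length
  unbounded : ∀ n, ∃ k, n ≤ (M (initSeg p k)).length

theorem Computes.getElem?_eq {M : List Bool → List Bool} {p q : Cantor} (h : Computes M p q)
    {k i : ℕ} {b : Bool} (hb : (M (initSeg p k))[i]? = some b) : q i = b := by
  have hi : i < (M (initSeg p k)).length := (List.getElem?_eq_some_iff.1 hb).1
  rw [h.eq_initSeg, getElem?_initSeg hi] at hb
  exact Option.some.inj hb

theorem Computes.exists_getElem? {M : List Bool → List Bool} {p q : Cantor} (h : Computes M p q)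
    (i : ℕ) : ∃ k, (M (initSeg p k))[i]? = some (q i) := by
  obtain ⟨k, hk⟩ := h.unbounded (i + 1)
  exact ⟨k, by rw [h.eq_initSeg, getElem?_initSeg hk]⟩

/-- By monotonicity, any output on a prefix of `p` is comparable with a longer output that begins
with a long initial segment of `q`; hence it is itself an initial segment of `q`. -/
theorem IsComputable.exists_machine {F : Cantor →. Cantor} (hF : IsComputable F) :
    ∃ M : List Bool → List Bool, Computable M ∧ ∀ p q, q ∈ F p → Computes M p q := by
  obtain ⟨M, hM, hmono, hgrow⟩ := hF
  refine ⟨M, hM, fun p q hq => ⟨fun k => ?_, fun n => ?_⟩⟩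
  · obtain ⟨j, hj⟩ := hgrow p q hq (M (initSeg p k)).length
    have h1 : M (initSeg p k) <+: M (initSeg p (max j k)) :=
      hmono _ _ (initSeg_prefix (le_max_right _ _))
    have h2 := hj.trans (hmono _ _ (initSeg_prefix (le_max_left j k)))
    exact (List.prefix_of_prefix_length_le h1 h2 (by simp [length_initSeg])).eq_of_length
      (by simp [length_initSeg])
  · obtain ⟨k, hk⟩ := hgrow p q hq n
    exact ⟨k, by simpa [length_initSeg] using hk.length_le⟩

/-- A total function whose `k`-th output bit is computed from the first `g k` input bits is
computable. -/
theorem isComputable_of_bit {F : Cantor → Cantor} {g : ℕ → ℕ} {b : List Bool → ℕ → Bool}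
    (hg : Primrec g) (hb : Computable₂ b) (hF : ∀ p k, F p k = b (initSeg p (g k)) k) :
    IsComputable (F : Cantor →. Cantor) := by
  -- `N l` is the number of output bits that can be written after `l` input bits; the cut-off at `l`
  -- keeps the search finite.
  let N : ℕ → ℕ := fun l => (List.range l).findIdx fun k => decide (l < g k)
  have lt_N {l k : ℕ} : k < N l ↔ k < l ∧ ∀ j ≤ k, g j ≤ l := by
    simp [N]
  have hN : Primrec N := by
    refine Primrec.list_findIdx Primrec.list_range (PrimrecPred.decide ?_)
    exact PrimrecRel.comp Primrec.nat_lt Primrec.fst (hg.comp Primrec.snd)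
  have hmono {l m : ℕ} (h : l ≤ m) : N l ≤ N m := by
    refine le_of_forall_lt fun k hk => ?_
    rw [lt_N] at hk ⊢
    exact ⟨hk.1.trans_le h, fun j hj => (hk.2 j hj).trans h⟩
  refine ⟨fun u => (List.range (N u.length)).map fun k => b (u.take (g k)) k,
    computable_list_map_range (hN.to_comp.comp Computable.list_length) ?_, ?_, ?_⟩
  · exact hb.comp (Primrec.list_take.to_comp.comp (hg.to_comp.comp Computable.snd) Computable.fst)
      Computable.snd
  · intro u v huv
    have hl := hmono huv.length_le
    have : (List.range (N u.length)).map (fun k => b (u.take (g k)) k)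
        = ((List.range (N v.length)).map fun k => b (v.take (g k)) k).take (N u.length) := by
      rw [← List.map_take, List.take_range, min_eq_left hl]
      refine List.map_congr_left fun k hk => ?_
      obtain ⟨t, rfl⟩ := huv
      rw [List.take_append_of_le_length ((lt_N.1 (List.mem_range.1 hk)).2 k le_rfl)]
    beta_reduce
    rw [this]
    exact List.take_prefix _ _
  · intro p q hq n
    obtain rfl : q = F p := by simpa using hq
    obtain ⟨l, hl⟩ : ∃ l, n ≤ N l := by
      obtain ⟨m, hm⟩ := ((Set.finite_Iic n).image g).bddAbove
      refine ⟨max (n + 1) m, (lt_N.2 ⟨by simp, fun j hj => ?_⟩).le⟩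
      exact le_max_of_le_right (hm ⟨j, hj, rfl⟩)
    refine ⟨l, ?_⟩
    beta_reduce
    rw [length_initSeg]
    have : (List.range (N l)).map (fun k => b ((initSeg p l).take (g k)) k) = initSeg (F p) (N l) :=
      List.map_congr_left fun k hk => by
        rw [take_initSeg ((lt_N.1 (List.mem_range.1 hk)).2 k le_rfl), hF]
    rw [this]
    exact initSeg_prefix hl

/-! ### Open sets, the jump and its injectivity -/

theorem mem_openSet_iff {α : Type} [Primcodable α] {n : ℕ} {p : ℕ → α} :
    p ∈ openSet n ↔ ∃ k, WDom n (initSeg p k) := Iff.rfl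

theorem mem_preimage_openSet {f : Cantor →. Cantor} {n : ℕ} {p y : Cantor} (hy : y ∈ f p) :
    p ∈ f.preimage (openSet n) ↔ y ∈ openSet n := by
  rw [PFun.mem_preimage]
  constructor
  · rintro ⟨z, hz, hzp⟩
    rwa [Part.mem_unique hy hzp]
  · exact fun h => ⟨y, h, hy⟩

theorem jump_apply_of_mem {q : Baire} {n : ℕ} (h : q ∈ openSet n) : jump q n = 1 := if_pos h

theorem jump_apply_of_notMem {q : Baire} {n : ℕ} (h : q ∉ openSet n) : jump q n = 0 := if_neg h

theorem jump_eq_one_iff {q : Baire} {n : ℕ} : jump q n = 1 ↔ q ∈ openSet n := by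
  simp [jump]

/-- There are indices of the sets `{q | q i = j}`. -/
theorem exists_openSet_index_apply_eq :
    ∃ s : ℕ → ℕ, ∀ (n : ℕ) (q : Baire), q ∈ openSet (s n) ↔ q n.unpair.1 = n.unpair.2 := by
  obtain ⟨s, -, hs⟩ := exists_wDom_index (α := List ℕ)
    (T := fun n u _ => decide (u[n.unpair.1]? = some n.unpair.2)) (by
      have hn : Primrec fun x : (ℕ × List ℕ) × ℕ => x.1.1.unpair :=
        Primrec.unpair.comp (Primrec.fst.comp Primrec.fst)
      exact (PrimrecPred.decide (PrimrecRel.comp Primrec.eq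
        (Primrec.list_getElem?.comp (Primrec.snd.comp Primrec.fst) (Primrec.fst.comp hn))
        (Primrec.option_some.comp (Primrec.snd.comp hn)))).to_comp)
  refine ⟨s, fun n q => ?_⟩
  simp only [mem_openSet_iff, hs, exists_const, decide_eq_true_eq]
  constructor
  · rintro ⟨k, hk⟩
    have hlt : n.unpair.1 < k := by
      simpa [length_initSeg] using (List.getElem?_eq_some_iff.1 hk).1
    simpa [getElem?_initSeg hlt] using hk
  · intro h
    exact ⟨n.unpair.1 + 1, by rw [getElem?_initSeg (Nat.lt_succ_self _), h]⟩

/-- The sets `{q | q i = j}` are among the `U_n`, so the jump decides every value of `q`. -/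
theorem jump_injective : Function.Injective jump := by
  obtain ⟨s, hs⟩ := exists_openSet_index_apply_eq
  intro q r h
  funext i
  have hq := (hs (Nat.pair i (q i)) q).2 (by simp)
  rw [← jump_eq_one_iff, h, jump_eq_one_iff, hs] at hq
  simpa using hq.symm

theorem lowMap_unique {x : ℕ → Baire} {q r : Baire} (hq : q ∈ lowMap x) (hr : r ∈ lowMap x) :
    q = r :=
  jump_injective (tendsto_nhds_unique hq hr)

theorem mem_lowMap_iff {x : ℕ → Baire} {q : Baire} :
    q ∈ lowMap x ↔ ∀ n, ∀ᶠ i in Filter.atTop, x i n = jump q n := by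
  simp [lowMap, tendsto_pi_nhds, nhds_discrete]

/-! ### Names in Baire space -/

/-- The initial segment of `graphName q` determined by an initial segment of `q`. -/
def graphWord (w : List ℕ) : List Bool :=
  (List.range w.length).map fun k => decide (w[k.unpair.1]? = some k.unpair.2)

theorem primrec_graphWord : Primrec graphWord := by
  refine Primrec.list_map (Primrec.list_range.comp Primrec.list_length) ?_
  have hk : Primrec fun x : List ℕ × ℕ => x.2.unpair := Primrec.unpair.comp Primrec.snd
  exact PrimrecPred.decide (PrimrecRel.comp Primrec.eq
    (Primrec.list_getElem?.comp Primrec.fst (Primrec.fst.comp hk))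
    (Primrec.option_some.comp (Primrec.snd.comp hk)))

/-- Bit `⟨a, b⟩` of the name depends only on `q a`, and `a ≤ ⟨a, b⟩`; so `k` values of `q` determine
`k` bits. -/
theorem graphWord_initSeg (q : Baire) (k : ℕ) :
    graphWord (initSeg q k) = initSeg (graphName q) k := by
  unfold graphWord
  rw [length_initSeg]
  refine List.map_congr_left fun i hi => ?_
  rw [getElem?_initSeg ((Nat.unpair_left_le i).trans_lt (List.mem_range.1 hi))]
  simp [graphName]

/-- Cantor space as a subset of Baire space. -/
def toBaire (p : Cantor) : Baire := fun n => (p n).toNat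

/-- Preimages of open sets under `toBaire` are open, uniformly in an index. -/
theorem exists_openSet_index_toBaire :
    ∃ t : ℕ → ℕ, Computable t ∧
      ∀ (n : ℕ) (p : Cantor), p ∈ openSet (t n) ↔ toBaire p ∈ openSet n := by
  obtain ⟨t, ht, hs⟩ := exists_wDom_index (α := List Bool)
    (T := fun n u k => haltsBy k n (u.map Bool.toNat)) (by
      refine (primrec_haltsBy Primrec.snd (Primrec.fst.comp Primrec.fst) ?_).to_comp
      exact Primrec.list_map (Primrec.snd.comp Primrec.fst)
        ((Primrec.dom_finite Bool.toNat).comp Primrec.snd))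
  refine ⟨t, ht, fun n p => ?_⟩
  simp only [mem_openSet_iff, hs, map_initSeg, ← wDom_iff_haltsBy]
  rfl

/-- Preimages of open sets under a computable function on names are open, uniformly in an
index. -/
theorem exists_openSet_index_machine {M : List Bool → List Bool} (hM : Computable M) :
    ∃ s : ℕ → ℕ, Computable s ∧ ∀ (n : ℕ) (q : Baire) (y : Cantor), Computes M (graphName q) y →
      (q ∈ openSet (s n) ↔ y ∈ openSet n) := by
  obtain ⟨s, hs, h⟩ := exists_wDom_index (α := List ℕ)
    -- `k` codes a step bound and a prefix length. Truncation is needed because `M` may write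
    -- several bits at once and skip the word that witnesses membership.
    (T := fun n w k => haltsBy k.unpair.1 n ((M (graphWord w)).take k.unpair.2)) (by
      have h1 : Computable fun x : (ℕ × List ℕ) × ℕ => (M (graphWord x.1.2)).take x.2.unpair.2 :=
        Primrec.list_take.to_comp.comp
          (Primrec.snd.comp (Primrec.unpair.comp Primrec.snd)).to_comp
          (hM.comp (primrec_graphWord.comp (Primrec.snd.comp Primrec.fst)).to_comp)
      exact computable_haltsBy (Primrec.fst.comp (Primrec.unpair.comp Primrec.snd)).to_comp
        (Primrec.fst.comp Primrec.fst).to_comp h1)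
  refine ⟨s, hs, fun n q y hy => ?_⟩
  simp only [mem_openSet_iff, h, graphWord_initSeg]
  constructor
  · rintro ⟨k, m, hm⟩
    have hpre : (M (initSeg (graphName q) k)).take m.unpair.2 <+:
        initSeg y (M (initSeg (graphName q) k)).length :=
      hy.eq_initSeg k ▸ List.take_prefix _ _
    exact ⟨_, wDom_iff_haltsBy.2 ⟨_, eq_of_prefix_initSeg hpre ▸ hm⟩⟩
  · rintro ⟨k, hk⟩
    obtain ⟨m, hm⟩ := wDom_iff_haltsBy.1 hk
    obtain ⟨l, hl⟩ := hy.unbounded k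
    refine ⟨l, Nat.pair m k, ?_⟩
    rwa [Nat.unpair_pair, hy.eq_initSeg, take_initSeg hl]

/-- The sets `{p | ∃ j ≥ i, F p ⟨⟨j, m⟩, 1⟩ = b}` form a computable double sequence of open
sets when `F` is computed by `M`. -/
theorem exists_openSeq_index_tail {M : List Bool → List Bool} (hM : Computable M) {s : ℕ → ℕ}
    (hs : Computable s) (b : Bool) :
    ∃ a : ℕ → ℕ, Computable a ∧ ∀ (n i : ℕ) (p z : Cantor), Computes M p z →
      (p ∈ openSeq (a n) i ↔ ∃ j, i ≤ j ∧ z (Nat.pair (Nat.pair j (s n)) 1) = b) := by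
  obtain ⟨a, ha, h⟩ := exists_wDom_index (α := ℕ × List Bool)
    (T := fun n x k => decide ((M x.2)[Nat.pair (Nat.pair (x.1 + k) (s n)) 1]? = some b)) (by
      have h1 : Computable fun x : (ℕ × ℕ × List Bool) × ℕ =>
          Nat.pair (Nat.pair (x.1.2.1 + x.2) (s x.1.1)) 1 :=
        Primrec₂.natPair.to_comp.comp
          (Primrec₂.natPair.to_comp.comp
            (Primrec.nat_add.comp (Primrec.fst.comp (Primrec.snd.comp Primrec.fst))
              Primrec.snd).to_comp
            (hs.comp (Computable.fst.comp Computable.fst)))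
          (Computable.const 1)
      have h2 : Primrec fun o : Option Bool => decide (o = some b) :=
        PrimrecPred.decide (PrimrecRel.comp Primrec.eq Primrec.id (Primrec.const _))
      exact h2.to_comp.comp (Computable.list_getElem?.comp
        (hM.comp (Primrec.snd.comp (Primrec.snd.comp Primrec.fst)).to_comp) h1))
  refine ⟨a, ha, fun n i p z hz => ?_⟩
  simp only [openSeq, Set.mem_ofPred_eq, h, decide_eq_true_eq]
  constructor
  · rintro ⟨k, j, hj⟩
    exact ⟨i + j, by omega, hz.getElem?_eq hj⟩
  · rintro ⟨j, hij, hj⟩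
    obtain ⟨k, hk⟩ := hz.exists_getElem? (Nat.pair (Nat.pair j (s n)) 1)
    refine ⟨k, j - i, ?_⟩
    rw [Nat.add_sub_cancel' hij, hk, hj]

/-! ### From a reduction to Markov-effective measurability -/

theorem mem_reprCantor {p x : Cantor} : x ∈ reprCantor.toPFun p ↔ x = p :=
  Representation.mem_ofInjective id Function.injective_id p x

theorem mem_reprBaire {p : Cantor} {x : Baire} : x ∈ reprBaire.toPFun p ↔ graphName x = p :=
  Representation.mem_ofInjective _ graphName_injective p x

theorem mem_reprBaireSeq {p : Cantor} {x : ℕ → Baire} :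
    x ∈ reprBaireSeq.toPFun p ↔ graphName (join x) = p :=
  Representation.mem_ofInjective _ (graphName_injective.comp join_injective) p x

/-- The least realizer of `lowMap`: it is defined exactly on the names of points of the domain. -/
theorem exists_least_realizer_lowMap :
    ∃ G : Cantor →. Cantor, IsRealizer reprBaireSeq reprBaire G lowMap ∧
      ∀ r w, w ∈ G r → ∃ x q, r = graphName (join x) ∧ w = graphName q ∧ q ∈ lowMap x := by
  classical
  let R (r : Cantor) (xq : (ℕ → Baire) × Baire) : Prop :=
    r = graphName (join xq.1) ∧ xq.2 ∈ lowMap xq.1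
  refine ⟨fun r => ⟨∃ xq, R r xq, fun h => graphName h.choose.2⟩, ?_, ?_⟩
  · rintro r x hx ⟨q, hq⟩
    have h : ∃ xq, R r xq := ⟨(x, q), (mem_reprBaireSeq.1 hx).symm, hq⟩
    have hxx : h.choose.1 = x :=
      join_injective (graphName_injective (h.choose_spec.1.symm.trans (mem_reprBaireSeq.1 hx).symm))
    exact ⟨_, ⟨h, rfl⟩, h.choose.2, mem_reprBaire.2 rfl, by simpa only [hxx] using h.choose_spec.2⟩
  · rintro r w ⟨h, rfl⟩
    exact ⟨_, _, h.choose_spec.1, rfl, h.choose_spec.2⟩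

theorem isMarkovDeltaMeasurable_of_le {f : Cantor →. Cantor}
    (h : StrongWeihrauchLE reprCantor reprCantor reprBaireSeq reprBaire (toMulti f) lowMap) :
    IsMarkovDeltaMeasurable f := by
  obtain ⟨H, K, hH, hK, hred⟩ := h
  obtain ⟨MH, hMH, hHc⟩ := hH.exists_machine
  obtain ⟨MK, hMK, hKc⟩ := hK.exists_machine
  obtain ⟨s, hs, hsH⟩ := exists_openSet_index_machine hMH
  obtain ⟨a, ha, haK⟩ := exists_openSeq_index_tail hMK hs false
  obtain ⟨b, hb, hbK⟩ := exists_openSeq_index_tail hMK hs true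
  -- With a realizer undefined off the names of domain points, definedness of `H ∘ G ∘ K` at `p`
  -- forces `K p` to name a sequence in the domain of `lowMap`.
  obtain ⟨G, hG, hGleast⟩ := exists_least_realizer_lowMap
  have key : ∀ p y, y ∈ f p → ∃ x q, Computes MK p (graphName (join x)) ∧
      Computes MH (graphName q) y ∧ q ∈ lowMap x := by
    intro p y hy
    obtain ⟨z, hz, y', hy', hyf⟩ := hred G hG p p (mem_reprCantor.2 rfl) ⟨y, hy⟩
    obtain rfl : y' = z := mem_reprCantor.1 hy'
    obtain rfl : y' = y := Part.mem_unique hyf hy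
    rw [PFun.comp_apply, PFun.comp_apply] at hz
    obtain ⟨w, hw, hz⟩ := Part.mem_bind_iff.1 hz
    obtain ⟨r, hr, hw⟩ := Part.mem_bind_iff.1 hw
    obtain ⟨x, q, rfl, rfl, hq⟩ := hGleast r w hw
    exact ⟨x, q, hKc _ _ hr, hHc _ _ hz, hq⟩
  have hbit (x : ℕ → Baire) (j m : ℕ) (c : Bool) :
      graphName (join x) (Nat.pair (Nat.pair j m) 1) = c ↔ decide (x j m = 1) = c := by
    simp [graphName, join]
  -- The closed sets are `{p | ∀ j ≥ i, x j (s n) = 1}`, given by their complements `a n`; the open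
  -- sets `b n` are `{p | ∃ j ≥ i, x j (s n) = 1}`.
  refine ⟨fun n => Part.some (Nat.pair (a n) (b n)), ?_, fun n => ⟨_, Part.mem_some _, ?_, ?_⟩⟩
  · exact Partrec.nat_iff.1 (Primrec₂.natPair.to_comp.comp ha hb).partrec
  all_goals
    ext p
    rw [Nat.unpair_pair]
    refine Iff.trans ?_ (and_congr (Iff.refl (p ∈ f.Dom)) Iff.rfl)
    by_cases hp : p ∈ f.Dom
    swap
    · exact iff_of_false (fun h => hp (PFun.preimage_subset_dom f _ h)) (fun h => hp h.1)
    obtain ⟨y, hy⟩ := (PFun.mem_dom f p).1 hp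
    obtain ⟨x, q, hKx, hHq, hq⟩ := key p y hy
    have hlim := mem_lowMap_iff.1 hq (s n)
    rw [mem_preimage_openSet hy, ← hsH n q y hHq, ← jump_eq_one_iff]
    obtain ⟨N, hN⟩ := Filter.eventually_atTop.1 hlim
    simp only [hp, true_and, haK _ _ _ _ hKx, hbK _ _ _ _ hKx, hbit, decide_eq_true_eq,
      decide_eq_false_iff_not]
  · constructor
    · intro h
      refine ⟨N, ?_⟩
      rintro ⟨j, hj, hj'⟩
      exact hj' ((hN j hj).trans h)
    · rintro ⟨i, hi⟩
      rw [← hN (max i N) (le_max_right _ _)]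
      by_contra hne
      exact hi ⟨_, le_max_left _ _, hne⟩
  · constructor
    · exact fun h i => ⟨max i N, le_max_left _ _, (hN _ (le_max_right _ _)).trans h⟩
    · intro h
      obtain ⟨j, hj, hj'⟩ := h N
      exact (hN j hj).symm.trans hj'

open Filter

/-! ### From Markov-effective measurability to a reduction -/

/-- Reading `u` and running for `u.length` steps suffices to enumerate `u` into the `l`-th open
set of the `m`-th sequence. -/
def entered (m l : ℕ) (u : List Bool) : Bool :=
  (List.range (u.length + 1)).any fun k => haltsBy u.length m (l, u.take k)

theorem primrec_entered : Primrec fun x : (ℕ × List Bool) × ℕ => entered x.1.1 x.2 x.1.2 := by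
  have hu : Primrec fun x : (ℕ × List Bool) × ℕ => x.1.2 := Primrec.snd.comp Primrec.fst
  refine primrec_list_any (Primrec.list_range.comp
    (Primrec.succ.comp (Primrec.list_length.comp hu))) ?_
  exact primrec_haltsBy (Primrec.list_length.comp (hu.comp Primrec.fst))
    (Primrec.fst.comp (Primrec.fst.comp Primrec.fst))
    (Primrec.pair (Primrec.snd.comp Primrec.fst)
      (Primrec.list_take.comp Primrec.snd (hu.comp Primrec.fst)))

theorem entered_initSeg {m l i : ℕ} {p : Cantor} :
    entered m l (initSeg p i) ↔ ∃ k ≤ i, haltsBy i m (l, initSeg p k) := by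
  simp only [entered, List.any_eq_true, List.mem_range, length_initSeg, Nat.lt_succ_iff]
  refine exists_congr fun k => and_congr_right fun hk => ?_
  rw [take_initSeg hk]

theorem mem_openSeq_of_entered {m l i : ℕ} {p : Cantor} (h : entered m l (initSeg p i)) :
    p ∈ openSeq m l := by
  obtain ⟨k, -, hk⟩ := entered_initSeg.1 h
  exact ⟨k, wDom_iff_haltsBy.2 ⟨i, hk⟩⟩

theorem eventually_entered {m l : ℕ} {p : Cantor} (h : p ∈ openSeq m l) :
    ∀ᶠ i in atTop, entered m l (initSeg p i) := by
  obtain ⟨k, hk⟩ := h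
  obtain ⟨j, hj⟩ := wDom_iff_haltsBy.1 hk
  filter_upwards [eventually_ge_atTop j, eventually_ge_atTop k] with i hji hki
  exact entered_initSeg.2 ⟨k, hki, haltsBy_mono hji hj⟩

/-- The number of initial members of the `m`-th sequence of open sets that `u` has entered. -/
def enteredCount (m : ℕ) (u : List Bool) : ℕ :=
  (List.range u.length).findIdx fun l => !entered m l u

theorem primrec_enteredCount : Primrec₂ enteredCount :=
  Primrec.list_findIdx (Primrec.list_range.comp (Primrec.list_length.comp Primrec.snd))
    (Primrec.not.comp primrec_entered)

theorem lt_enteredCount {m k i : ℕ} {p : Cantor} :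
    k < enteredCount m (initSeg p i) ↔ k < i ∧ ∀ l ≤ k, entered m l (initSeg p i) := by
  simp [enteredCount, length_initSeg]

/-- A set that never gets entered blocks the count at its index forever. -/
theorem enteredCount_le {m l : ℕ} {p : Cantor} (h : p ∉ openSeq m l) (i : ℕ) :
    enteredCount m (initSeg p i) ≤ l :=
  le_of_not_gt fun hlt => h (mem_openSeq_of_entered ((lt_enteredCount.1 hlt).2 l le_rfl))

theorem eventually_lt_enteredCount {m : ℕ} {p : Cantor} (h : ∀ l, p ∈ openSeq m l) (k : ℕ) :
    ∀ᶠ i in atTop, k < enteredCount m (initSeg p i) := by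
  have hall : ∀ᶠ i in atTop, ∀ l ∈ Set.Iic k, entered m l (initSeg p i) :=
    (eventually_all_finite (Set.finite_Iic k)).2 fun l _ => eventually_entered (h l)
  filter_upwards [eventually_gt_atTop k, hall] with i hi hl
  exact lt_enteredCount.2 ⟨hi, hl⟩

/-- The guess, on the basis of `u`, whether a point belongs to the `Δ⁰₂` set with index `m`. -/
def deltaGuess (m : ℕ) (u : List Bool) : Bool :=
  decide (enteredCount m.unpair.1 u ≤ enteredCount m.unpair.2 u)

theorem primrec_deltaGuess : Primrec₂ deltaGuess := by
  have hm : Primrec fun x : ℕ × List Bool => x.1.unpair := Primrec.unpair.comp Primrec.fst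
  exact PrimrecPred.decide (PrimrecRel.comp Primrec.nat_le
    (primrec_enteredCount.comp (Primrec.fst.comp hm) Primrec.snd)
    (primrec_enteredCount.comp (Primrec.snd.comp hm) Primrec.snd))

open Classical in
/-- The guesses converge to the truth. -/
theorem IsDeltaIndex.eventually_deltaGuess {X D : Set Cantor} {m : ℕ} (h : IsDeltaIndex X m D)
    {p : Cantor} (hp : p ∈ X) : ∀ᶠ i in atTop, deltaGuess m (initSeg p i) = decide (p ∈ D) := by
  have h1 : p ∈ D ↔ p ∈ X ∧ ∃ i, p ∉ openSeq m.unpair.1 i := Set.ext_iff.1 h.1 p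
  have h2 : p ∈ D ↔ p ∈ X ∧ ∀ i, p ∈ openSeq m.unpair.2 i := Set.ext_iff.1 h.2 p
  by_cases hD : p ∈ D
  · obtain ⟨-, l, hl⟩ := h1.1 hD
    -- The complement count is stuck at most at `l`, while the other count eventually exceeds `l`.
    filter_upwards [eventually_lt_enteredCount (h2.1 hD).2 l] with i hi
    simpa [deltaGuess, hD] using (enteredCount_le hl i).trans hi.le
  · obtain ⟨l, hl⟩ : ∃ l, p ∉ openSeq m.unpair.2 l := by
      by_contra! hall
      exact hD (h2.2 ⟨hp, hall⟩)
    have hall : ∀ l, p ∈ openSeq m.unpair.1 l := by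
      by_contra! hex
      exact hD (h1.2 ⟨hp, hex⟩)
    filter_upwards [eventually_lt_enteredCount hall l] with i hi
    simpa [deltaGuess, hD] using (enteredCount_le hl i).trans_lt hi

theorem IsMarkovDeltaMeasurable.exists_computable {f : Cantor →. Cantor}
    (h : IsMarkovDeltaMeasurable f) :
    ∃ g : ℕ → ℕ, Computable g ∧ ∀ n, IsDeltaIndex f.Dom (g n) (f.preimage (openSet n)) := by
  obtain ⟨P, hP, h⟩ := h
  choose g hg hidx using h
  refine ⟨g, ?_, hidx⟩
  exact (Partrec.nat_iff.2 hP).of_eq fun n => Part.eq_some_iff.2 (hg n)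

/-- Recovers a point of Cantor space from a name of its image under `toBaire`. -/
def ofGraphName (r : Cantor) : Cantor := fun n => r (Nat.pair n 1)

theorem ofGraphName_graphName_toBaire (p : Cantor) : ofGraphName (graphName (toBaire p)) = p := by
  funext n
  cases h : p n <;> simp [ofGraphName, graphName, toBaire, h]

theorem isComputable_ofGraphName : IsComputable (ofGraphName : Cantor →. Cantor) := by
  have hpair : Primrec fun k => Nat.pair k 1 := Primrec₂.natPair.comp Primrec.id (Primrec.const 1)
  -- One bit beyond position `⟨k, 1⟩` is read, so on such a prefix the default `false` is never
  -- used.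
  refine isComputable_of_bit (g := fun k => Nat.pair k 1 + 1)
    (b := fun u k => (u[Nat.pair k 1]?).getD false) (Primrec.succ.comp hpair) ?_ fun p k => ?_
  · exact (Primrec.option_getD.comp
      (Primrec.list_getElem?.comp Primrec.fst (hpair.comp Primrec.snd))
      (Primrec.const false)).to_comp
  · rw [getElem?_initSeg (Nat.lt_succ_self _)]
    rfl

/-- The sequence of guesses about the sets with indices `g 0, g 1, …`. -/
def guessSeq (g : ℕ → ℕ) (p : Cantor) : ℕ → Baire :=
  fun i n => (deltaGuess (g n) (initSeg p i)).toNat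

/-- The `k`-th bit of the name of `guessSeq g p` when `u` is the relevant part of `p`. -/
def guessBit (g : ℕ → ℕ) (u : List Bool) (k : ℕ) : Bool :=
  decide ((deltaGuess (g k.unpair.1.unpair.2) u).toNat = k.unpair.2)

theorem computable_guessBit {g : ℕ → ℕ} (hg : Computable g) : Computable₂ (guessBit g) := by
  have hidx : Computable fun x : List Bool × ℕ => g x.2.unpair.1.unpair.2 :=
    hg.comp (Primrec.snd.comp (Primrec.unpair.comp (Primrec.fst.comp
      (Primrec.unpair.comp Primrec.snd)))).to_comp
  have hguess : Computable fun x : List Bool × ℕ => deltaGuess (g x.2.unpair.1.unpair.2) x.1 :=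
    Computable₂.comp primrec_deltaGuess.to_comp hidx Computable.fst
  have hval : Computable fun x : List Bool × ℕ => x.2.unpair.2 :=
    (Primrec.snd.comp (Primrec.unpair.comp Primrec.snd)).to_comp
  have heq : Primrec₂ fun (b : Bool) (n : ℕ) => decide (b.toNat = n) :=
    PrimrecPred.decide (PrimrecRel.comp Primrec.eq
      ((Primrec.dom_finite Bool.toNat).comp Primrec.fst) Primrec.snd)
  exact heq.to_comp.comp hguess hval

theorem isComputable_guessSeq {g : ℕ → ℕ} (hg : Computable g) :
    IsComputable ((fun p => graphName (join (guessSeq g p)) : Cantor → Cantor) :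
      Cantor →. Cantor) :=
  -- Bit `⟨⟨i, n⟩, v⟩` of the name concerns the `i`-th guess, which reads exactly `i` bits of `p`.
  isComputable_of_bit (g := fun k => k.unpair.1.unpair.1)
    (Primrec.fst.comp (Primrec.unpair.comp (Primrec.fst.comp Primrec.unpair)))
    (computable_guessBit hg) fun _ _ => rfl

theorem le_of_isMarkovDeltaMeasurable {f : Cantor →. Cantor} (h : IsMarkovDeltaMeasurable f) :
    StrongWeihrauchLE reprCantor reprCantor reprBaireSeq reprBaire (toMulti f) lowMap := by
  classical
  obtain ⟨g, hg, hidx⟩ := h.exists_computable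
  obtain ⟨t, ht, htB⟩ := exists_openSet_index_toBaire
  -- The jump concerns open sets of Baire space, so each index is first translated by `t` to one for
  -- Cantor space and then passed to `g`.
  refine ⟨_, _, isComputable_ofGraphName, isComputable_guessSeq (hg.comp ht), ?_⟩
  rintro G hG p x hx ⟨y, hy⟩
  obtain rfl : x = p := mem_reprCantor.1 hx
  have hlow : toBaire y ∈ lowMap (guessSeq (fun n => g (t n)) x) := by
    refine mem_lowMap_iff.2 fun n => ?_
    have hdom : x ∈ f.Dom := (PFun.mem_dom f x).2 ⟨y, hy⟩
    filter_upwards [(hidx (t n)).eventually_deltaGuess hdom] with i hi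
    rw [guessSeq, hi]
    by_cases hn : toBaire y ∈ openSet n
    · rw [jump_apply_of_mem hn, decide_eq_true ((mem_preimage_openSet hy).2 ((htB n y).2 hn))]
      rfl
    · rw [jump_apply_of_notMem hn,
        decide_eq_false fun hc => hn ((htB n y).1 ((mem_preimage_openSet hy).1 hc))]
      rfl
  obtain ⟨w, hw, q, hq, hql⟩ := hG _ _ (mem_reprBaireSeq.2 rfl) ⟨_, hlow⟩
  obtain rfl := lowMap_unique hlow hql
  obtain rfl : graphName (toBaire y) = w := mem_reprBaire.1 hq
  refine ⟨y, ?_, y, mem_reprCantor.2 rfl, hy⟩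
  rw [PFun.comp_apply, PFun.comp_apply]
  refine Part.mem_bind_iff.2 ⟨_, Part.mem_bind_iff.2 ⟨_, Part.mem_some _, hw⟩, ?_⟩
  simp [ofGraphName_graphName_toBaire]

end TTE

theorem corollary14 (f : TTE.Cantor →. TTE.Cantor) :
    TTE.IsMarkovDeltaMeasurable f ↔
      TTE.StrongWeihrauchLE TTE.reprCantor TTE.reprCantor TTE.reprBaireSeq TTE.reprBaire
        (TTE.toMulti f) TTE.lowMap :=
  ⟨TTE.le_of_isMarkovDeltaMeasurable, TTE.isMarkovDeltaMeasurable_of_le⟩
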